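/- For a group $H$ and $n\ge 1$ let $H^n$ denote the subgroup generated by all $n$th powers of elements of $H$. Let $p$ be a prime. A finite $p$-group $G$ is called powerful if $p>2$ and $G'\le G^p$, or $p=2$ and $G'\le G^4$, where $G'$ is the commutator subgroup. For a finite $p$-group $H$ and an integer $m\ge 0$ let $\Omega_m(H)$ be the subgroup generated by all elements of $H$ whose order divides $p^m$; for $m<0$ put $\Omega_m(H)=\{1\}$. Let $G$ be a powerful $p$-group, and let $i,j\ge 0$ and $k\ge 1$ be integers. Then $$\bigl(\Omega_i(G^{p^k})\bigr)^{p^j}\le \Omega_{i-j}(G^{p^{k+j}})\qquad\text{and}\qquad \exp\Bigl(\bigl(\Omega_i(G^{p^k})\bigr)^{p^j}\Bigr)\le p^{i-j},$$ where $\exp$ denotes the exponent of a group and, when $i<j$, the second inequality means that $\bigl(\Omega_i(G^{p^k})\bigr)^{p^j}$ is the trivial group. -/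

import Mathlib

namespace PowerfulGroup

/-- For a subgroup `H` of `G`, the subgroup `H ^ n` generated by all `n`-th powers of elements of
`H`, viewed as a subgroup of `G`. The group `G ^ n` itself is `powerSubgroup ⊤ n`. -/
def powerSubgroup {G : Type*} [Group G] (H : Subgroup G) (n : ℕ) : Subgroup G :=
  Subgroup.closure {x : G | ∃ h ∈ H, h ^ n = x}

/-- For a subgroup `H` of `G`, the subgroup `Ω_i(H)`, viewed as a subgroup of `G`: it is generated
by all elements of `H` whose order divides `p ^ i` if `i ≥ 0`, and it is trivial if `i < 0`. -/
def omega {G : Type*} [Group G] (p : ℕ) (i : ℤ) (H : Subgroup G) : Subgroup G :=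
  if 0 ≤ i then Subgroup.closure {x : G | x ∈ H ∧ orderOf x ∣ p ^ i.toNat} else ⊥

/-- The assertion `exp H ≤ p ^ i` for an integer `i`; for `i < 0` it means that `H` is trivial. -/
def ExponentLE {G : Type*} [Group G] (p : ℕ) (i : ℤ) (H : Subgroup G) : Prop :=
  if 0 ≤ i then Monoid.exponent H ≤ p ^ i.toNat else H = ⊥

/-- `G` is a powerful `p`-group: a finite `p`-group with `G' ≤ G ^ p` if `p > 2`, and with
`G' ≤ G ^ 4` if `p = 2`. -/
structure IsPowerful (p : ℕ) (G : Type*) [Group G] : Prop where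
  finite : Finite G
  isPGroup : IsPGroup p G
  commutator_le : (2 < p ∧ commutator G ≤ powerSubgroup (⊤ : Subgroup G) p) ∨
    (p = 2 ∧ commutator G ≤ powerSubgroup (⊤ : Subgroup G) 4)

end PowerfulGroup

open scoped commutatorElement

namespace PowerfulGroup

/-! ### Commutator identities for `p`-th powers -/

variable {G : Type*} [Group G]

/-! Write N_k for G^{p^k}. In a powerful group [N_k, N_l] ≤ N_{k+l+s}, with s = 1 for odd p and s =
2 for p = 2, and every element of N_{k+1} is the p-th power of an element of N_k. The crux is that
in N_1 the elements of order dividing p^e are closed under products (`isTorsionClosed_one`). Hence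
for k ≥ 1 the group Ω_i(N_k) consists exactly of the x in N_k with x^{p^i} = 1; then x^{p^j} lies in
N_{k+j} and has order dividing p^{i-j}, or is trivial if i < j, which gives both claims.

Closure is proved for abstract filtrations by induction on their length, the shifted series N_{k+1}
being known. `DifferenceBound` and `CommutatorBound` are proved together by descending induction on
a, both being trivial for large a. The first follows from (xd)^p ≡ x^p d^p modulo elements of order
dividing p^{a-1}, together with the shifted series. Applied to x and a conjugate of x, it gives the
depth-zero case of the second, which root extraction carries to greater depth. Finally, elements of
N_1 of order dividing p^{e+1} commute modulo those of order dividing p^e, and closure follows by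
induction on e. -/

theorem mul_pow_of_commute_commutator {u w : G} (hu : Commute ⁅w, u⁆ u) (hw : Commute ⁅w, u⁆ w)
    (n : ℕ) : (u * w) ^ n = u ^ n * w ^ n * ⁅w, u⁆ ^ n.choose 2 := by
  have key : ∀ n : ℕ, w ^ n * u = u * w ^ n * ⁅w, u⁆ ^ n := by
    intro n
    induction n with
    | zero => simp
    | succ n ih =>
      have h1 : w * u = u * w * ⁅w, u⁆ := by
        have : w * u = ⁅w, u⁆ * (u * w) := by simp [commutatorElement_def, mul_assoc]
        rw [this, (hu.mul_right hw).eq]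
      calc w ^ (n + 1) * u = w ^ n * (w * u) := by rw [pow_succ, mul_assoc]
        _ = (w ^ n * u) * w * ⁅w, u⁆ := by rw [h1]; simp only [mul_assoc]
        _ = u * w ^ n * (⁅w, u⁆ ^ n * w) * ⁅w, u⁆ := by rw [ih]; simp only [mul_assoc]
        _ = u * w ^ n * (w * ⁅w, u⁆ ^ n) * ⁅w, u⁆ := by rw [(hw.pow_left n).eq]
        _ = u * w ^ (n + 1) * ⁅w, u⁆ ^ (n + 1) := by simp only [pow_succ, mul_assoc]
  induction n with
  | zero => simp
  | succ n ih =>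
    have hc : ⁅w, u⁆ ^ n.choose 2 * (u * w) = u * w * ⁅w, u⁆ ^ n.choose 2 :=
      ((hu.mul_right hw).pow_left _).eq
    calc (u * w) ^ (n + 1) = u ^ n * w ^ n * (⁅w, u⁆ ^ n.choose 2 * (u * w)) := by
          rw [pow_succ, ih, mul_assoc]
      _ = u ^ n * (w ^ n * u) * w * ⁅w, u⁆ ^ n.choose 2 := by rw [hc]; simp only [mul_assoc]
      _ = u ^ n * (u * w ^ n) * (⁅w, u⁆ ^ n * w) * ⁅w, u⁆ ^ n.choose 2 := by
          rw [key]; simp only [mul_assoc]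
      _ = u ^ n * (u * w ^ n) * (w * ⁅w, u⁆ ^ n) * ⁅w, u⁆ ^ n.choose 2 := by
          rw [(hw.pow_left n).eq]
      _ = u ^ (n + 1) * w ^ (n + 1) * ⁅w, u⁆ ^ (n + 1).choose 2 := by
          rw [Nat.choose_succ_succ' n 1, Nat.choose_one_right]
          simp only [pow_succ, pow_add, mul_assoc]

/-- For odd p the binomial coefficient is divisible by p. For p = 2 it equals 1, which is why `p =
2` needs separate, stronger hypotheses from here on. -/
theorem pow_choose_two_eq_one {p : ℕ} (hp : p.Prime) {g : G} (hg : g ^ p = 1)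
    (h2 : p = 2 → g = 1) : g ^ p.choose 2 = 1 := by
  rcases hp.eq_two_or_odd' with h | h
  · simp [h2 h]
  · obtain ⟨m, hm⟩ := hp.dvd_choose_self (k := 2) two_ne_zero (by
      have := hp.two_le
      rcases this.lt_or_eq with h' | h'
      · exact h'
      · subst h'; exact absurd h (by decide))
    rw [hm, pow_mul, hg, one_pow]

theorem mul_pow_prime {p : ℕ} (hp : p.Prime) {u w : G} (hu : Commute ⁅w, u⁆ u)
    (hw : Commute ⁅w, u⁆ w) (hg : ⁅w, u⁆ ^ p = 1) (h2 : p = 2 → ⁅w, u⁆ = 1) :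
    (u * w) ^ p = u ^ p * w ^ p := by
  rw [mul_pow_of_commute_commutator hu hw, pow_choose_two_eq_one hp hg h2, mul_one]

/-- With f = [w, v], conjugation by v sends w to f⁻¹w, and (f⁻¹w)^p = f⁻ᵖ w^p = w^p. -/
theorem commute_pow_prime {p : ℕ} (hp : p.Prime) {w v : G} (hf : ⁅w, v⁆ ^ p = 1)
    (hg : ⁅⁅w, v⁆, w⁆ ^ p = 1) (h2 : p = 2 → ⁅⁅w, v⁆, w⁆ = 1)
    (hgw : Commute ⁅⁅w, v⁆, w⁆ w) (hgf : Commute ⁅⁅w, v⁆, w⁆ ⁅w, v⁆) : Commute (w ^ p) v := by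
  set f := ⁅w, v⁆ with hfdef
  have e1 : ⁅w, f⁻¹⁆ = ⁅f, w⁆ := by
    have : ⁅w, f⁻¹⁆ = f⁻¹ * ⁅f, w⁆ * f := by simp [commutatorElement_def, mul_assoc]
    rw [this, mul_assoc, hgf.eq, inv_mul_cancel_left]
  have e2 : v * w * v⁻¹ = f⁻¹ * w := by simp [hfdef, commutatorElement_def, mul_assoc]
  have e3 : (f⁻¹ * w) ^ p = f⁻¹ ^ p * w ^ p := by
    apply mul_pow_prime hp <;> rw [e1]
    exacts [hgf.inv_right, hgw, hg, h2]
  rw [← e2, conj_pow, inv_pow, hf, inv_one, one_mul] at e3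
  exact (mul_inv_eq_iff_eq_mul.mp e3).symm

section Quotient

variable (Q : Subgroup G) [hQ : Q.Normal]

theorem mk_commute_iff {x y : G} : Commute (x : G ⧸ Q) (y : G ⧸ Q) ↔ ⁅x, y⁆ ∈ Q := by
  rw [← QuotientGroup.eq_one_iff, ← commutatorElement_eq_one_iff_commute]
  exact Iff.rfl

theorem mk_commutator (x y : G) : ((⁅x, y⁆ : G) : G ⧸ Q) = ⁅(x : G ⧸ Q), (y : G ⧸ Q)⁆ := rfl

/-- The `p`-th power map is multiplicative on `u, w` modulo a normal subgroup `Q` containing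
suitable commutators. -/
theorem mk_mul_pow_prime {p : ℕ} (hp : p.Prime) {u w : G} (hu : ⁅⁅w, u⁆, u⁆ ∈ Q)
    (hw : ⁅⁅w, u⁆, w⁆ ∈ Q) (hg : ⁅w, u⁆ ^ p ∈ Q) (h2 : p = 2 → ⁅w, u⁆ ∈ Q) :
    (((u * w) ^ p : G) : G ⧸ Q) = ((u ^ p * w ^ p : G) : G ⧸ Q) := by
  rw [← mk_commute_iff, mk_commutator] at hu hw
  simp only [← QuotientGroup.eq_one_iff, QuotientGroup.mk_pow, mk_commutator] at hg h2
  exact mul_pow_prime hp hu hw hg h2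

theorem commutator_pow_prime_mem {p : ℕ} (hp : p.Prime) {w v : G} (hf : ⁅w, v⁆ ^ p ∈ Q)
    (hg : ⁅⁅w, v⁆, w⁆ ^ p ∈ Q) (h2 : p = 2 → ⁅⁅w, v⁆, w⁆ ∈ Q)
    (hgw : ⁅⁅⁅w, v⁆, w⁆, w⁆ ∈ Q) (hgf : ⁅⁅⁅w, v⁆, w⁆, ⁅w, v⁆⁆ ∈ Q) : ⁅w ^ p, v⁆ ∈ Q := by
  rw [← mk_commute_iff] at hgw hgf ⊢
  simp only [← QuotientGroup.eq_one_iff, QuotientGroup.mk_pow, mk_commutator] at hf hg h2 hgw hgf ⊢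
  exact commute_pow_prime hp hf hg h2 hgw hgf

theorem commutator_pow_prime_mem' {p : ℕ} (hp : p.Prime) {w v : G} (hf : ⁅w, v⁆ ^ p ∈ Q)
    (hg : ⁅⁅w, v⁆, w⁆ ∈ Q) : ⁅w ^ p, v⁆ ∈ Q := by
  have h : ∀ y, ⁅⁅⁅w, v⁆, w⁆, y⁆ ∈ Q := fun y => by
    rw [commutatorElement_def, mul_assoc, mul_assoc, ← mul_assoc y]
    exact Q.mul_mem hg (hQ.conj_mem _ (Q.inv_mem hg) y)
  exact commutator_pow_prime_mem Q hp hf (Q.pow_mem hg p) (fun _ => hg) (h _) (h _)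

end Quotient

/-! ### Power filtrations and torsion -/

/-- A descending series of normal subgroups behaving like the series `G ^ (p ^ k)` of a powerful
`p`-group `G`. -/
structure IsPowerFiltration (p s : ℕ) (N : ℕ → Subgroup G) : Prop where
  normal : ∀ k, (N k).Normal
  antitone : Antitone N
  commutator_mem : ∀ {k l : ℕ} {x y : G}, x ∈ N k → y ∈ N l → ⁅x, y⁆ ∈ N (k + l + s)
  pow_mem : ∀ {k : ℕ} {x : G}, x ∈ N k → x ^ p ∈ N (k + 1)
  exists_root : ∀ {k : ℕ} {x : G}, x ∈ N (k + 1) → ∃ w ∈ N k, w ^ p = x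

theorem IsPowerFiltration.shift {p s : ℕ} {N : ℕ → Subgroup G} (hN : IsPowerFiltration p s N) :
    IsPowerFiltration p s (fun k => N (k + 1)) where
  normal k := hN.normal _
  antitone _ _ h := hN.antitone (by omega)
  commutator_mem hx hy := hN.antitone (by omega) (hN.commutator_mem hx hy)
  pow_mem hx := hN.pow_mem hx
  exists_root hx := hN.exists_root hx

theorem pow_prime_pow_mono {p e e' : ℕ} {x : G} (hx : x ^ p ^ e = 1) (h : e ≤ e') :
    x ^ p ^ e' = 1 := by
  obtain ⟨c, rfl⟩ := Nat.exists_eq_add_of_le h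
  rw [pow_add, pow_mul, hx, one_pow]

theorem pow_prime_pow_sub_one {p e : ℕ} {x : G} (hx : x ^ p ^ e = 1) :
    (x ^ p) ^ p ^ (e - 1) = 1 := by
  rw [← pow_mul, ← pow_succ']
  exact pow_prime_pow_mono hx (by omega)

theorem pow_prime_pow_of_root {p e : ℕ} {x : G} (hx : (x ^ p) ^ p ^ e = 1) :
    x ^ p ^ (e + 1) = 1 := by
  rwa [pow_succ', pow_mul]

theorem pow_eq_one_of_conj {x y : G} {n : ℕ} (hx : x ^ n = 1) : (y * x * y⁻¹) ^ n = 1 := by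
  rw [conj_pow, hx, mul_one, mul_inv_cancel]

/-- For every `e`, the elements of `H` whose order divides `p ^ e` are closed under
multiplication. -/
def IsTorsionClosed (p : ℕ) (H : Subgroup G) : Prop :=
  ∀ (e : ℕ) (x y : G), x ∈ H → y ∈ H → x ^ p ^ e = 1 → y ^ p ^ e = 1 → (x * y) ^ p ^ e = 1

theorem exists_torsion_subgroup {p e : ℕ} {H : Subgroup G} (hH : H.Normal)
    (hcl : ∀ x y : G, x ∈ H → y ∈ H → x ^ p ^ e = 1 → y ^ p ^ e = 1 → (x * y) ^ p ^ e = 1) :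
    ∃ Q : Subgroup G, Q.Normal ∧ ∀ z, z ∈ Q ↔ z ∈ H ∧ z ^ p ^ e = 1 := by
  refine ⟨{ carrier := {z | z ∈ H ∧ z ^ p ^ e = 1}
            mul_mem' := fun ha hb => ⟨H.mul_mem ha.1 hb.1, hcl _ _ ha.1 hb.1 ha.2 hb.2⟩
            one_mem' := ⟨H.one_mem, one_pow _⟩
            inv_mem' := fun ha => ⟨H.inv_mem ha.1, by rw [inv_pow, ha.2, inv_one]⟩ }, ⟨?_⟩,
    fun z => Iff.rfl⟩
  exact fun n hn g => ⟨hH.conj_mem _ hn.1 g, pow_eq_one_of_conj hn.2⟩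

theorem IsTorsionClosed.mono {p : ℕ} {H K : Subgroup G} (h : IsTorsionClosed p H) (hK : K ≤ H) :
    IsTorsionClosed p K :=
  fun e x y hx hy => h e x y (hK hx) (hK hy)

/-- A bound for the orders of commutators of elements whose orders and depths satisfy
`log (order) + depth ≤ a` and `≤ a + 1`, respectively. -/
def CommutatorBound (p : ℕ) (N : ℕ → Subgroup G) (a : ℕ) : Prop :=
  ∀ (k l : ℕ) (x y : G), x ∈ N k → y ∈ N l → x ^ p ^ (a - k) = 1 → y ^ p ^ (a + 1 - l) = 1 →
    ⁅x, y⁆ ^ p ^ (a - k - l) = 1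

theorem CommutatorBound.pow_eq_one {p a : ℕ} {N : ℕ → Subgroup G} (h : CommutatorBound p N a)
    {k l e e' c : ℕ} {x y : G} (hx : x ∈ N k) (hy : y ∈ N l) (hx' : x ^ p ^ e = 1)
    (hy' : y ^ p ^ e' = 1)
    (he : (e ≤ a - k ∧ e' ≤ a + 1 - l) ∨ (e ≤ a + 1 - k ∧ e' ≤ a - l)) (hc : a - k - l ≤ c) :
    ⁅x, y⁆ ^ p ^ c = 1 := by
  rcases he with he | he
  · exact pow_prime_pow_mono
      (h k l x y hx hy (pow_prime_pow_mono hx' he.1) (pow_prime_pow_mono hy' he.2)) hc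
  · rw [← commutatorElement_inv, inv_pow, inv_eq_one]
    exact pow_prime_pow_mono
      (h l k y x hy hx (pow_prime_pow_mono hy' he.2) (pow_prime_pow_mono hx' he.1)) (by omega)

/-- If `x` and `x * d` have order dividing `p ^ a` and `d` lies deep enough, then `d` has order
dividing `p ^ a`. -/
def DifferenceBound (p s : ℕ) (N : ℕ → Subgroup G) (a : ℕ) : Prop :=
  ∀ x d : G, x ∈ N 0 → d ∈ N s → x ^ p ^ a = 1 → (x * d) ^ p ^ a = 1 → d ^ p ^ a = 1

/-! ### Order bounds by descending induction -/

variable {p s : ℕ} {N : ℕ → Subgroup G}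

/-- Replacing w by w^p gains a factor p in the order of the commutator: modulo the deep elements of
order dividing p^{a-m-n-1}, the bound at a + 1 kills the higher commutators that obstruct this. -/
theorem commutator_pow_bound (hp : p.Prime) (hs : 1 ≤ s) (hs2 : p = 2 → 2 ≤ s)
    (hN : IsPowerFiltration p s N) (hcl : IsTorsionClosed p (N 2)) {a : ℕ}
    (hD : CommutatorBound p N (a + 1)) {m n : ℕ} {w v : G} (hw : w ∈ N m) (hv : v ∈ N n)
    (hwa : w ^ p ^ (a + 1 - m) = 1) (hf : ⁅w, v⁆ ^ p ^ (a - m - n) = 1) :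
    ⁅w ^ p, v⁆ ^ p ^ (a - m - n - 1) = 1 := by
  obtain ⟨Q, hQ, hQm⟩ := exists_torsion_subgroup (e := a - m - n - 1) (hN.normal 2) (hcl _)
  have hfN := hN.commutator_mem hw hv
  have hgN := hN.commutator_mem hfN hw
  have hg : ⁅⁅w, v⁆, w⁆ ^ p ^ (a - n - 2 * m) = 1 :=
    hD.pow_eq_one (hN.antitone (show m + n + 1 ≤ m + n + s by omega) hfN) hw hf hwa
      (by omega) (by omega)
  have hgN' := hN.antitone (show n + 2 * m + 2 ≤ m + n + s + m + s by omega) hgN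
  refine ((hQm _).1 (commutator_pow_prime_mem Q hp ?_ ?_ ?_ ?_ ?_)).2 <;> rw [hQm]
  · exact ⟨hN.antitone (by omega) (hN.pow_mem hfN), pow_prime_pow_sub_one hf⟩
  · exact ⟨hN.antitone (by omega) (hN.pow_mem hgN),
      pow_prime_pow_mono (pow_prime_pow_sub_one hg) (by omega)⟩
  · intro h2
    have := hs2 h2
    exact ⟨hN.antitone (by omega) hgN,
      hD.pow_eq_one (hN.antitone (show m + n + 2 ≤ m + n + s by omega) hfN) hw hf hwa
        (by omega) (by omega)⟩
  · exact ⟨hN.antitone (by omega) (hN.commutator_mem hgN hw),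
      hD.pow_eq_one hgN' hw hg hwa (by omega) (by omega)⟩
  · exact ⟨hN.antitone (by omega) (hN.commutator_mem hgN hfN),
      hD.pow_eq_one hgN' (hN.antitone (show m + n + 1 ≤ m + n + s by omega) hfN) hg hf
        (by omega) (by omega)⟩

/-- The conjugate v x v⁻¹ has the order of x and differs from x by a conjugate of [v, x]. -/
theorem DifferenceBound.commutator_pow_eq_one (hN : IsPowerFiltration p s N) {a j k : ℕ}
    (h : ∀ x d : G, x ∈ N 0 → d ∈ N k → x ^ p ^ a = 1 → (x * d) ^ p ^ a = 1 → d ^ p ^ a = 1)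
    {x v : G} (hx : x ∈ N 0) (hv : v ∈ N j) (hj : k ≤ j + s) (hxa : x ^ p ^ a = 1) :
    ⁅v, x⁆ ^ p ^ a = 1 := by
  have hc : ⁅v, x⁆ ∈ N k := hN.antitone (by omega) (hN.commutator_mem hv hx)
  have h1 : x⁻¹ * ⁅v, x⁆ * x ∈ N k := by
    simpa using (hN.normal k).conj_mem _ hc x⁻¹
  have h2 : x * (x⁻¹ * ⁅v, x⁆ * x) = v * x * v⁻¹ := by simp [commutatorElement_def, mul_assoc]
  have h3 := h x _ hx h1 hxa (by rw [h2]; exact pow_eq_one_of_conj hxa)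
  have h4 := pow_eq_one_of_conj (y := x) h3
  simpa [mul_assoc] using h4

/-- Induction on total depth k + l. A root of a deep element is one step shallower with order at
most p times larger, so order plus depth is preserved. -/
theorem commutatorBound_of_succ (hp : p.Prime) (hs : 1 ≤ s) (hs2 : p = 2 → 2 ≤ s)
    (hN : IsPowerFiltration p s N) (hcl : IsTorsionClosed p (N 2)) {a : ℕ}
    (hD : CommutatorBound p N (a + 1)) (hd : DifferenceBound p s N a) :
    CommutatorBound p N a := by
  suffices H : ∀ n k l : ℕ, k + l = n → ∀ x y : G, x ∈ N k → y ∈ N l → x ^ p ^ (a - k) = 1 →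
      y ^ p ^ (a + 1 - l) = 1 → ⁅x, y⁆ ^ p ^ (a - k - l) = 1 from fun k l => H _ k l rfl
  intro n
  induction n with
  | zero =>
    intro k l hkl x y hx hy hxa _
    obtain ⟨rfl, rfl⟩ : k = 0 ∧ l = 0 := by omega
    rw [← commutatorElement_inv, inv_pow, inv_eq_one]
    exact DifferenceBound.commutator_pow_eq_one hN hd hx hy (by omega) hxa
  | succ n ih =>
    intro k l hkl x y hx hy hxa hya
    rcases Nat.eq_zero_or_pos l with rfl | hl
    · obtain ⟨k, rfl⟩ : ∃ k', k = k' + 1 := ⟨n, by omega⟩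
      rcases le_or_gt (k + 1) a with hk | hk
      · obtain ⟨w, hw, rfl⟩ := hN.exists_root hx
        have hw' := pow_prime_pow_mono (e' := a - k) (pow_prime_pow_of_root hxa) (by omega)
        have := commutator_pow_bound hp hs hs2 hN hcl hD hw hy
          (pow_prime_pow_mono hw' (by omega)) (ih k 0 (by omega) w y hw hy hw' hya)
        exact pow_prime_pow_mono this (by omega)
      · rw [show a - (k + 1) = 0 by omega, pow_zero, pow_one] at hxa
        simp [hxa]
    · obtain ⟨l, rfl⟩ : ∃ l', l = l' + 1 := ⟨l - 1, by omega⟩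
      rw [← commutatorElement_inv, inv_pow, inv_eq_one]
      rcases le_or_gt (l + 1) (a + 1) with hk | hk
      · obtain ⟨w, hw, rfl⟩ := hN.exists_root hy
        have hw' := pow_prime_pow_mono (e' := a + 1 - l) (pow_prime_pow_of_root hya) (by omega)
        have h1 := ih k l (by omega) x w hx hw hxa hw'
        rw [← commutatorElement_inv, inv_pow, inv_eq_one, Nat.sub_right_comm] at h1
        have := commutator_pow_bound hp hs hs2 hN hcl hD hw hx hw' h1
        exact pow_prime_pow_mono this (by omega)
      · rw [show a + 1 - (l + 1) = 0 by omega, pow_zero, pow_one] at hya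
        simp [hya]

theorem differenceBound_of_forall_gt (hp : p.Prime) (hs : 1 ≤ s) (hs2 : p = 2 → s = 2)
    (hN : IsPowerFiltration p s N) {M : ℕ} (hM : N M = ⊥) (hcl : IsTorsionClosed p (N 2))
    (hshift : ∀ b, DifferenceBound p s (fun k => N (k + 1)) b) {a : ℕ}
    (hD : ∀ b, a < b → CommutatorBound p N b) (hd : DifferenceBound p s N (a + 1)) :
    DifferenceBound p s N a := by
  -- The main argument uses exponent `a - 1`, so truncation at `a = 0` must be excluded.
  rcases Nat.eq_zero_or_pos a with rfl | ha
  · intro x d _ _ hx hxd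
    simp only [pow_zero, pow_one] at hx hxd ⊢
    rwa [hx, one_mul] at hxd
  -- Descending induction on the depth k of d, starting where N_k is trivial.
  suffices H : ∀ n k, M ≤ k + n → s ≤ k → ∀ x d : G, x ∈ N 0 → d ∈ N k → x ^ p ^ a = 1 →
      (x * d) ^ p ^ a = 1 → d ^ p ^ a = 1 from H M s (by omega) le_rfl
  intro n
  induction n with
  | zero =>
    intro k hk _ x d _ hdk _ _
    have : d ∈ N M := hN.antitone (by omega) hdk
    rw [hM, Subgroup.mem_bot] at this
    simp [this]
  | succ n ih =>
    intro k hk hsk x d hx hdk hxa hxda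
    have star : ∀ {j : ℕ} {v : G}, v ∈ N j → k + 1 ≤ j + s → ⁅v, x⁆ ^ p ^ a = 1 := fun hv hj =>
      DifferenceBound.commutator_pow_eq_one hN (ih (k + 1) (by omega) (by omega)) hx hv hj hxa
    have hda : d ^ p ^ (a + 1) = 1 := hd x d hx (hN.antitone hsk hdk)
      (pow_prime_pow_mono hxa (by omega)) (pow_prime_pow_mono hxda (by omega))
    have hDk := hD (a + k + 1) (by omega)
    obtain ⟨Q, hQ, hQm⟩ := exists_torsion_subgroup (e := a - 1) (hN.normal (s + 1))
      (hcl.mono (hN.antitone (by omega)) _)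
    have hgN := hN.commutator_mem hdk hx
    have hga := star hdk (by omega)
    have hgp : ⁅d, x⁆ ^ p ∈ Q :=
      (hQm _).2 ⟨hN.antitone (by omega) (hN.pow_mem hgN), pow_prime_pow_sub_one hga⟩
    have hgN' := hN.antitone (show k + 1 ≤ k + 0 + s by omega) hgN
    have hgd : ⁅⁅d, x⁆, d⁆ ∈ Q := (hQm _).2 ⟨hN.antitone (by omega) (hN.commutator_mem hgN hdk),
      hDk.pow_eq_one hgN' hdk hga hda (by omega) (by omega)⟩
    -- Since x has depth only 0, the commutator bound does not apply directly. Instead [d, x] is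
    -- written as h^p, and [h^p, x] is controlled through [h, x].
    have hgx : ⁅⁅d, x⁆, x⁆ ∈ Q := by
      obtain ⟨h, hh, hhg⟩ := hN.exists_root hgN'
      have hha : h ^ p ^ (a + 1) = 1 := pow_prime_pow_of_root (by rw [hhg, hga])
      have hqN := hN.commutator_mem hh hx
      have hqa := star hh (by omega)
      rw [← hhg]
      refine commutator_pow_prime_mem' Q hp ?_ ?_ <;> rw [hQm]
      · exact ⟨hN.antitone (by omega) (hN.pow_mem hqN), pow_prime_pow_sub_one hqa⟩
      · exact ⟨hN.antitone (by omega) (hN.commutator_mem hqN hh),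
          hDk.pow_eq_one (hN.antitone (show k + 1 ≤ k + 0 + s by omega) hqN) hh hqa hha
            (by omega) (by omega)⟩
    have hg2 : p = 2 → ⁅d, x⁆ ∈ Q := by
      intro h2
      have := hs2 h2
      obtain ⟨k, rfl⟩ : ∃ k', k = k' + 1 := ⟨k - 1, by omega⟩
      obtain ⟨e, he, rfl⟩ := hN.exists_root hdk
      have hea : e ^ p ^ (a + 1 + 1) = 1 := pow_prime_pow_of_root hda
      have hqN := hN.commutator_mem he hx
      have hqa := star he (by omega)
      refine commutator_pow_prime_mem' Q hp ?_ ?_ <;> rw [hQm]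
      · exact ⟨hN.antitone (by omega) (hN.pow_mem hqN), pow_prime_pow_sub_one hqa⟩
      · exact ⟨hN.antitone (by omega) (hN.commutator_mem hqN he),
          hDk.pow_eq_one (hN.antitone (show k + 2 ≤ k + 0 + s by omega) hqN) he hqa hea
            (by omega) (by omega)⟩
    have hmul := mk_mul_pow_prime Q hp hgx hgd hgp hg2
    rw [QuotientGroup.eq] at hmul
    have hdpN := hN.antitone (show s + 1 ≤ k + 1 by omega) (hN.pow_mem hdk)
    set r := ((x * d) ^ p)⁻¹ * (x ^ p * d ^ p) with hr
    have hxd : x * d ∈ N 0 := (N 0).mul_mem hx (hN.antitone (by omega) hdk)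
    -- The error r is absorbed into d^p, so that the product with x^p is exactly (xd)^p; the shifted
    -- series then applies to p-th powers.
    have hD2 := hshift (a - 1) (x ^ p) (d ^ p * r⁻¹) (hN.pow_mem hx)
      ((N (s + 1)).mul_mem hdpN ((N (s + 1)).inv_mem ((hQm r).1 hmul).1))
      (pow_prime_pow_sub_one hxa) (by
        have : x ^ p * (d ^ p * r⁻¹) = (x * d) ^ p := by rw [hr]; group
        rw [this]
        exact pow_prime_pow_sub_one hxda)
    have hdQ : d ^ p * r⁻¹ ∈ Q :=
      (hQm _).2 ⟨(N (s + 1)).mul_mem hdpN ((N (s + 1)).inv_mem ((hQm r).1 hmul).1), hD2⟩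
    have hdp : d ^ p ∈ Q := by simpa using Q.mul_mem hdQ hmul
    exact pow_prime_pow_mono (pow_prime_pow_of_root ((hQm _).1 hdp).2) (by omega)

theorem pow_prime_pow_eq_one_of_mem (hN : IsPowerFiltration p s N) {M : ℕ} (hM : N M = ⊥) {k : ℕ}
    {x : G} (hx : x ∈ N k) : x ^ p ^ (M - k) = 1 := by
  have key : ∀ n, x ^ p ^ n ∈ N (k + n) := by
    intro n
    induction n with
    | zero => simpa using hx
    | succ n ih => rw [pow_succ, pow_mul]; exact hN.pow_mem ih
  have := hN.antitone (show M ≤ k + (M - k) by omega) (key (M - k))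
  rwa [hM, Subgroup.mem_bot] at this

theorem commutatorBound_and_differenceBound (hp : p.Prime) (hs : 1 ≤ s) (hs2 : p = 2 → s = 2)
    (hN : IsPowerFiltration p s N) {M : ℕ} (hM : N M = ⊥) (hcl : IsTorsionClosed p (N 2))
    (hshift : ∀ b, DifferenceBound p s (fun k => N (k + 1)) b) (a : ℕ) :
    CommutatorBound p N a ∧ DifferenceBound p s N a := by
  suffices H : ∀ n a, M ≤ a + n → CommutatorBound p N a ∧ DifferenceBound p s N a from
    H M a (by omega)
  intro n
  induction n with
  | zero =>
    intro a ha
    refine ⟨fun k l x y hx hy _ _ => ?_, fun x d _ hd _ _ => ?_⟩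
    · exact pow_prime_pow_mono (pow_prime_pow_eq_one_of_mem hN hM (hN.commutator_mem hx hy))
        (by omega)
    · exact pow_prime_pow_mono (pow_prime_pow_eq_one_of_mem hN hM hd) (by omega)
  | succ n ih =>
    intro a ha
    have hd := differenceBound_of_forall_gt hp hs hs2 hN hM hcl hshift
      (fun b hb => (ih b (by omega)).1) (ih (a + 1) (by omega)).2
    exact ⟨commutatorBound_of_succ hp hs (fun h => (hs2 h).ge) hN hcl (ih (a + 1) (by omega)).1 hd,
      hd⟩

theorem isTorsionClosed_of_commutatorBound (hN : IsPowerFiltration p s N)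
    (hD : ∀ a, CommutatorBound p N a) : IsTorsionClosed p (N 1) := by
  intro e
  induction e with
  | zero =>
    intro x y _ _ hx hy
    simp only [pow_zero, pow_one] at hx hy ⊢
    rw [hx, hy, one_mul]
  | succ e ih =>
    intro x y hx hy hxe hye
    obtain ⟨Q, hQ, hQm⟩ := exists_torsion_subgroup (hN.normal 1) ih
    -- At a = e + 2 and depths k = l = 1, the bound on the commutator is p^{a-k-l} = p^e.
    have hc : ⁅x, y⁆ ∈ Q := (hQm _).2 ⟨hN.antitone (by omega) (hN.commutator_mem hx hy),
      (hD (e + 2)).pow_eq_one hx hy hxe hye (by omega) (by omega)⟩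
    have hpow : ((x * y) ^ p : G ⧸ Q) = x ^ p * y ^ p := ((mk_commute_iff Q).2 hc).mul_pow p
    have hroot : ∀ {z}, z ∈ N 1 → z ^ p ^ (e + 1) = 1 → (z : G ⧸ Q) ^ p = 1 := fun hz hze => by
      rw [← QuotientGroup.mk_pow, QuotientGroup.eq_one_iff, hQm]
      exact ⟨(N 1).pow_mem hz p, pow_prime_pow_sub_one hze⟩
    rw [hroot hx hxe, hroot hy hye, one_mul, ← QuotientGroup.mk_mul, ← QuotientGroup.mk_pow,
      QuotientGroup.eq_one_iff, hQm] at hpow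
    exact pow_prime_pow_of_root hpow.2

theorem isTorsionClosed_one (hp : p.Prime) (hs : 1 ≤ s) (hs2 : p = 2 → s = 2)
    (hN : IsPowerFiltration p s N) {M : ℕ} (hM : N M = ⊥) : IsTorsionClosed p (N 1) := by
  suffices H : ∀ M (N : ℕ → Subgroup G), IsPowerFiltration p s N → N M = ⊥ →
      (∀ b, DifferenceBound p s N b) ∧ IsTorsionClosed p (N 1) from (H M N hN hM).2
  intro M
  induction M with
  | zero =>
    intro N hN hM
    have h1 : ∀ {k x}, x ∈ N k → x = 1 := fun hx => by
      have := hN.antitone (Nat.zero_le _) hx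
      rwa [hM, Subgroup.mem_bot] at this
    refine ⟨fun b x d _ hd _ _ => ?_, fun e x y hx hy _ _ => ?_⟩
    · rw [h1 hd, one_pow]
    · rw [h1 hx, h1 hy, one_mul, one_pow]
  | succ M ih =>
    intro N hN hM
    obtain ⟨h1, h2⟩ := ih _ hN.shift hM
    have h := commutatorBound_and_differenceBound hp hs hs2 hN hM h2 h1
    exact ⟨fun b => (h b).2, isTorsionClosed_of_commutatorBound hN fun a => (h a).1⟩

/-! ### Power subgroups and commutator containments -/

theorem powerSubgroup_normal {H : Subgroup G} (hH : H.Normal) (n : ℕ) :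
    (powerSubgroup H n).Normal := by
  refine ⟨fun x hx g => ?_⟩
  induction hx using Subgroup.closure_induction with
  | mem x hx =>
    obtain ⟨h, hh, rfl⟩ := hx
    exact Subgroup.subset_closure ⟨_, hH.conj_mem h hh g, conj_pow⟩
  | one => simp [one_mem]
  | mul x y _ _ hx hy => simpa [mul_assoc] using mul_mem hx hy
  | inv x _ hx => simpa [mul_assoc] using inv_mem hx

theorem pow_mem_powerSubgroup {H : Subgroup G} {x : G} (hx : x ∈ H) (n : ℕ) :
    x ^ n ∈ powerSubgroup H n :=
  Subgroup.subset_closure ⟨x, hx, rfl⟩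

theorem powerSubgroup_le_iff {H K : Subgroup G} {n : ℕ} :
    powerSubgroup H n ≤ K ↔ ∀ x ∈ H, x ^ n ∈ K := by
  rw [powerSubgroup, Subgroup.closure_le]
  constructor
  · exact fun h x hx => h ⟨x, hx, rfl⟩
  · rintro h _ ⟨x, hx, rfl⟩
    exact h x hx

theorem powerSubgroup_le (H : Subgroup G) (n : ℕ) : powerSubgroup H n ≤ H :=
  powerSubgroup_le_iff.2 fun _ hx => H.pow_mem hx n

theorem exists_le_iff_commutator_le (P Z : Subgroup G) [hZ : Z.Normal] :
    ∃ C : Subgroup G, ∀ x, x ∈ C ↔ ∀ g ∈ P, ⁅x, g⁆ ∈ Z := by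
  refine ⟨(Subgroup.centralizer ((QuotientGroup.mk' Z) '' P)).comap (QuotientGroup.mk' Z),
    fun x => ?_⟩
  simp only [Subgroup.mem_comap, Subgroup.mem_centralizer_iff, Set.forall_mem_image,
    ← mk_commute_iff, SetLike.mem_coe, commute_iff_eq, QuotientGroup.mk'_apply]
  exact forall₂_congr fun _ _ => eq_comm

/-- The elements centralizing P modulo Z form a subgroup, so generators suffice. -/
theorem powerSubgroup_commutator_le {H P Z : Subgroup G} (hZ : Z.Normal) {n : ℕ}
    (h : ∀ x ∈ H, ∀ g ∈ P, ⁅x ^ n, g⁆ ∈ Z) : ⁅powerSubgroup H n, P⁆ ≤ Z := by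
  obtain ⟨C, hC⟩ := exists_le_iff_commutator_le P Z
  rw [Subgroup.commutator_le]
  exact fun x hx => (hC x).1 (powerSubgroup_le_iff.2 (fun x hx => (hC _).2 (h x hx)) hx)

/-- A version of the Frattini argument for central series: generators modulo `⁅X, G⁆` suffice. -/
theorem le_of_le_sup_commutator [Group.IsNilpotent G] {X Y : Subgroup G} (hY : Y.Normal)
    (h : X ≤ Y ⊔ ⁅X, ⊤⁆) : X ≤ Y := by
  obtain ⟨n, hn⟩ := (Subgroup.nilpotent_iff_lowerCentralSeries (G := G)).1 inferInstance
  suffices H : ∀ n, X ≤ Y ⊔ (⊤ : Subgroup G).lowerCentralSeries n by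
    simpa [hn] using H n
  intro n
  induction n with
  | zero => simp
  | succ n ih =>
    refine h.trans (sup_le le_sup_left ?_)
    rw [Subgroup.lowerCentralSeries_succ]
    set L := (⊤ : Subgroup G).lowerCentralSeries n
    obtain ⟨C, hC⟩ := exists_le_iff_commutator_le ⊤ (Y ⊔ ⁅L, ⊤⁆)
    have hYC : Y ≤ C := fun y hy => (hC y).2 fun g _ =>
      Subgroup.mem_sup_left (Subgroup.commutator_le_left Y ⊤
        (Subgroup.commutator_mem_commutator hy (Subgroup.mem_top g)))
    have hLC : L ≤ C := fun y hy => (hC y).2 fun g hg =>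
      Subgroup.mem_sup_right (Subgroup.commutator_mem_commutator hy hg)
    rw [Subgroup.commutator_le]
    exact fun x hx => (hC x).1 (sup_le hYC hLC (ih hx))

theorem commutator_pow_of_commute {f w : G} (h : Commute ⁅f, w⁆ f) (n : ℕ) :
    ⁅f ^ n, w⁆ = ⁅f, w⁆ ^ n := by
  have e : w * f⁻¹ * w⁻¹ = f⁻¹ * ⁅f, w⁆ := by simp [commutatorElement_def, mul_assoc]
  have e2 : ⁅f ^ n, w⁆ = f ^ n * (w * f⁻¹ * w⁻¹) ^ n := by
    rw [conj_pow, commutatorElement_def, inv_pow]; simp only [mul_assoc]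
  rw [e2, e, (h.inv_right.symm).mul_pow, inv_pow, mul_inv_cancel_left]

/-! ### The iterated power series as a filtration -/

/-- The iterated power subgroups `G`, `G ^ p`, `(G ^ p) ^ p`, and so on. -/
def powerSeries (G : Type*) [Group G] (p : ℕ) : ℕ → Subgroup G
  | 0 => ⊤
  | k + 1 => powerSubgroup (powerSeries G p k) p

theorem powerSeries_normal (k : ℕ) : (powerSeries G p k).Normal := by
  induction k with
  | zero => exact inferInstanceAs (⊤ : Subgroup G).Normal
  | succ k ih => exact powerSubgroup_normal ih p

theorem powerSeries_antitone : Antitone (powerSeries G p) :=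
  antitone_nat_of_succ_le fun k => powerSubgroup_le (powerSeries G p k) p

theorem pow_mem_powerSeries {k : ℕ} {x : G} (hx : x ∈ powerSeries G p k) :
    x ^ p ∈ powerSeries G p (k + 1) :=
  pow_mem_powerSubgroup hx p

theorem pow_pow_mem_powerSeries {k : ℕ} {x : G} (hx : x ∈ powerSeries G p k) (n : ℕ) :
    x ^ p ^ n ∈ powerSeries G p (k + n) := by
  induction n with
  | zero => simpa using hx
  | succ n ih => rw [pow_succ, pow_mul]; exact pow_mem_powerSeries ih

theorem commutator_powerSeries_top_le [Group.IsNilpotent G] (hp : p.Prime) (hs : 1 ≤ s)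
    (hs2 : p = 2 → 2 ≤ s) (h0 : ⁅(⊤ : Subgroup G), ⊤⁆ ≤ powerSeries G p s) (n : ℕ) :
    ⁅powerSeries G p n, ⊤⁆ ≤ powerSeries G p (n + s) := by
  induction n with
  | zero => rw [zero_add]; exact h0
  | succ n ih =>
    have hnorm := fun k => powerSeries_normal (G := G) (p := p) k
    have hanti := powerSeries_antitone (G := G) (p := p)
    set X := ⁅powerSeries G p (n + 1), (⊤ : Subgroup G)⁆
    set Y := powerSeries G p (n + 1 + s)
    apply le_of_le_sup_commutator (hnorm _)
    set Z := Y ⊔ ⁅X, ⊤⁆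
    have hX : ∀ {x : G}, x ∈ powerSeries G p (n + 1) → ∀ g, ⁅x, g⁆ ∈ X := fun hx g =>
      Subgroup.commutator_mem_commutator hx (Subgroup.mem_top g)
    have hXZ : ∀ {x : G}, x ∈ X → ∀ g, ⁅x, g⁆ ∈ Z := fun hx g =>
      Subgroup.mem_sup_right (Subgroup.commutator_mem_commutator hx (Subgroup.mem_top g))
    have hYZ : Y ≤ Z := le_sup_left
    have hf : ∀ {x : G}, x ∈ powerSeries G p n → ∀ g, ⁅x, g⁆ ∈ powerSeries G p (n + s) :=
      fun hx g => ih (Subgroup.commutator_mem_commutator hx (Subgroup.mem_top g))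
    have hfp : ∀ {x : G}, x ∈ powerSeries G p n → ∀ g, ⁅x, g⁆ ^ p ∈ Y := fun hx g =>
      hanti (by omega) (pow_mem_powerSeries (hf hx g))
    refine powerSubgroup_commutator_le inferInstance fun w hw v _ => ?_
    have hg := hX (hanti (by omega) (hf hw v)) w
    refine commutator_pow_prime_mem Z hp (hYZ (hfp hw v)) ?_ ?_ (hXZ hg _) (hXZ hg _)
    -- Modulo Z the commutator [[w, v], w] is central, so its p-th power is [[w, v]^p, w], which
    -- lies in Y.
    · have h1 : ⁅⁅w, v⁆ ^ p, w⁆ ∈ Z := hYZ (Subgroup.commutator_le_left Y ⊤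
        (Subgroup.commutator_mem_commutator (hfp hw v) (Subgroup.mem_top w)))
      have h2 := hXZ hg ⁅w, v⁆
      rw [← mk_commute_iff, mk_commutator] at h2
      rw [← QuotientGroup.eq_one_iff, mk_commutator, QuotientGroup.mk_pow,
        commutator_pow_of_commute h2] at h1
      rwa [← QuotientGroup.eq_one_iff]
    · intro h2
      -- For p = 2 the commutator itself must vanish modulo Z; here s ≥ 2 puts [w, v] in the term of
      -- index n + 2.
      have hle : ⁅powerSeries G p (n + 2), (⊤ : Subgroup G)⁆ ≤ Z :=
        powerSubgroup_commutator_le inferInstance fun u hu g _ =>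
          commutator_pow_prime_mem' Z hp (hYZ (hfp (hanti (Nat.le_succ n) hu) g)) (hXZ (hX hu g) u)
      exact hle (Subgroup.commutator_mem_commutator
        (hanti (Nat.add_le_add_left (hs2 h2) n) (hf hw v)) (Subgroup.mem_top w))

theorem commutator_powerSeries_le [Group.IsNilpotent G] (hp : p.Prime) (hs : 1 ≤ s)
    (hs2 : p = 2 → 2 ≤ s) (h0 : ⁅(⊤ : Subgroup G), ⊤⁆ ≤ powerSeries G p s) (k l : ℕ) :
    ⁅powerSeries G p k, powerSeries G p l⁆ ≤ powerSeries G p (k + l + s) := by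
  have htop := commutator_powerSeries_top_le hp hs hs2 h0
  have hanti := powerSeries_antitone (G := G) (p := p)
  induction k with
  | zero =>
    rw [Subgroup.commutator_comm, zero_add]
    exact (Subgroup.commutator_mono le_rfl le_top).trans (htop l)
  | succ k ih =>
    have := powerSeries_normal (G := G) (p := p) (k + 1 + l + s)
    refine powerSubgroup_commutator_le this fun w hw v hv => ?_
    have hf := ih (Subgroup.commutator_mem_commutator hw hv)
    exact commutator_pow_prime_mem' _ hp (hanti (by omega) (pow_mem_powerSeries hf))
      (hanti (by omega) (htop _ (Subgroup.commutator_mem_commutator hf (Subgroup.mem_top w))))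

/-- A subgroup of index p is normal, as p is the least prime divisor of the order, and so contains
all p-th powers. -/
theorem powerSubgroup_ne_top [Finite G] [Nontrivial G] (hp : p.Prime) (hG : IsPGroup p G) :
    powerSubgroup (⊤ : Subgroup G) p ≠ ⊤ := by
  have : Fact p.Prime := ⟨hp⟩
  obtain ⟨n, hn, hcard⟩ := hG.nontrivial_iff_card.1 inferInstance
  obtain ⟨n, rfl⟩ : ∃ m, n = m + 1 := ⟨n - 1, by omega⟩
  obtain ⟨K, hK⟩ := Sylow.exists_subgroup_card_pow_prime (G := G) p (n := n)
    (by rw [hcard]; exact pow_dvd_pow p n.le_succ)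
  have hidx : K.index = p := by
    have := K.card_mul_index
    rw [hK, hcard, pow_succ] at this
    exact Nat.eq_of_mul_eq_mul_left (pow_pos hp.pos n) this
  have : K.Normal := by
    apply Subgroup.normal_of_index_eq_minFac_card
    rw [hidx, hcard, hp.pow_minFac (Nat.succ_ne_zero n)]
  have hle : powerSubgroup (⊤ : Subgroup G) p ≤ K := powerSubgroup_le_iff.2 fun x _ => by
    simpa [hidx] using K.pow_index_mem x
  intro htop
  rw [htop, top_le_iff] at hle
  rw [hle, Subgroup.index_top] at hidx
  exact hp.one_lt.ne hidx

theorem powerSubgroup_lt [Finite G] (hp : p.Prime) (hG : IsPGroup p G) {H : Subgroup G}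
    (hH : H ≠ ⊥) : powerSubgroup H p < H := by
  refine (powerSubgroup_le H p).lt_of_ne fun h => ?_
  have : Nontrivial H := (Subgroup.nontrivial_iff_ne_bot H).2 hH
  refine powerSubgroup_ne_top hp (hG.to_subgroup H) ?_
  have h1 : H ≤ (powerSubgroup (⊤ : Subgroup H) p).map H.subtype := by
    conv_lhs => rw [← h]
    exact powerSubgroup_le_iff.2 fun x hx =>
      ⟨⟨x, hx⟩ ^ p, pow_mem_powerSubgroup (Subgroup.mem_top _) p, rfl⟩
  rw [eq_top_iff]
  intro x _
  obtain ⟨y, hy, hyx⟩ := h1 x.2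
  rwa [← Subtype.ext hyx]

theorem exists_powerSeries_eq_bot [Finite G] (hp : p.Prime) (hG : IsPGroup p G) :
    ∃ M, powerSeries G p M = ⊥ := by
  by_contra! h
  have : StrictAnti (powerSeries G p) :=
    strictAnti_nat_of_succ_lt fun k => powerSubgroup_lt hp hG (h k)
  exact not_injective_infinite_finite _ this.injective

theorem mk_mul_pow_powerSeries (hp : p.Prime) (hs : 1 ≤ s) (hs2 : p = 2 → 2 ≤ s)
    (hc : ∀ k l, ⁅powerSeries G p k, powerSeries G p l⁆ ≤ powerSeries G p (k + l + s))
    {j : ℕ} {x z : G} (hz : z ∈ powerSeries G p j) :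
    haveI := powerSeries_normal (G := G) (p := p) (j + 2)
    (((x * z) ^ p : G) : G ⧸ powerSeries G p (j + 2)) = ((x ^ p * z ^ p : G) : G ⧸ _) := by
  have := powerSeries_normal (G := G) (p := p) (j + 2)
  have hanti := powerSeries_antitone (G := G) (p := p)
  have hx : x ∈ powerSeries G p 0 := Subgroup.mem_top x
  have hz0 : z ∈ powerSeries G p 0 := Subgroup.mem_top z
  have hg := hc _ _ (Subgroup.commutator_mem_commutator hz hx)
  refine mk_mul_pow_prime _ hp ?_ ?_ ?_ ?_
  · exact hanti (by omega) (hc _ _ (Subgroup.commutator_mem_commutator hg hx))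
  · exact hanti (by omega) (hc _ _ (Subgroup.commutator_mem_commutator hg hz0))
  · exact hanti (by omega) (pow_mem_powerSeries hg)
  · exact fun h2 => hanti (by have := hs2 h2; omega) hg

theorem exists_root_mod_powerSeries (hp : p.Prime) (hs : 1 ≤ s) (hs2 : p = 2 → 2 ≤ s)
    (hc : ∀ k l, ⁅powerSeries G p k, powerSeries G p l⁆ ≤ powerSeries G p (k + l + s))
    {j : ℕ} {y : G} (hy : y ∈ powerSeries G p (j + 1)) :
    ∃ z ∈ powerSeries G p j, (z ^ p)⁻¹ * y ∈ powerSeries G p (j + 2) := by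
  have := powerSeries_normal (G := G) (p := p) (j + 2)
  simp only [← QuotientGroup.eq]
  induction hy using Subgroup.closure_induction with
  | mem x hx =>
    obtain ⟨h, hh, rfl⟩ := hx
    exact ⟨h, hh, rfl⟩
  | one => exact ⟨1, one_mem _, by rw [one_pow]⟩
  | mul x y _ _ hx hy =>
    obtain ⟨z, hz, hzx⟩ := hx
    obtain ⟨w, hw, hwy⟩ := hy
    refine ⟨z * w, mul_mem hz hw, ?_⟩
    rw [mk_mul_pow_powerSeries hp hs hs2 hc hw, QuotientGroup.mk_mul, hzx, hwy,
      QuotientGroup.mk_mul]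
  | inv x _ hx =>
    obtain ⟨z, hz, hzx⟩ := hx
    exact ⟨z⁻¹, inv_mem hz, by rw [inv_pow, QuotientGroup.mk_inv, hzx, QuotientGroup.mk_inv]⟩

/-- Successive approximation: each correction of the root pushes the error one term deeper, until
the series reaches the trivial group. -/
theorem exists_root_powerSeries (hp : p.Prime) (hs : 1 ≤ s) (hs2 : p = 2 → 2 ≤ s)
    (hc : ∀ k l, ⁅powerSeries G p k, powerSeries G p l⁆ ≤ powerSeries G p (k + l + s))
    {M : ℕ} (hM : powerSeries G p M = ⊥) {k : ℕ} {x : G} (hx : x ∈ powerSeries G p (k + 1)) :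
    ∃ w ∈ powerSeries G p k, w ^ p = x := by
  have hanti := powerSeries_antitone (G := G) (p := p)
  have key : ∀ n, ∃ w ∈ powerSeries G p k, (w ^ p)⁻¹ * x ∈ powerSeries G p (k + 1 + n) := by
    intro n
    induction n with
    | zero => exact ⟨1, one_mem _, by simpa using hx⟩
    | succ n ih =>
      obtain ⟨w, hw, hwx⟩ := ih
      obtain ⟨z, hz, hzx⟩ := exists_root_mod_powerSeries hp hs hs2 hc (j := k + n)
        (hanti (by omega) hwx)
      refine ⟨w * z, mul_mem hw (hanti (by omega) hz), hanti (by omega : _ ≤ k + n + 2) ?_⟩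
      have := powerSeries_normal (G := G) (p := p) (k + n + 2)
      rw [← QuotientGroup.eq] at hzx ⊢
      rw [mk_mul_pow_powerSeries hp hs hs2 hc hz, QuotientGroup.mk_mul, hzx,
        ← QuotientGroup.mk_mul, mul_inv_cancel_left]
  obtain ⟨w, hw, hwx⟩ := key M
  have h1 := hanti (show M ≤ k + 1 + M by omega) hwx
  rw [hM, Subgroup.mem_bot, inv_mul_eq_one] at h1
  exact ⟨w, hw, h1⟩

/-! ### Application to powerful groups -/

theorem IsPowerful.exists_isPowerFiltration (hp : p.Prime) (hG : IsPowerful p G) :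
    ∃ s, 1 ≤ s ∧ (p = 2 → s = 2) ∧ IsPowerFiltration p s (powerSeries G p) := by
  have := hG.finite
  have : Fact p.Prime := ⟨hp⟩
  have := hG.isPGroup.isNilpotent
  obtain ⟨M, hM⟩ := exists_powerSeries_eq_bot hp hG.isPGroup
  obtain ⟨s, hs, hs2, h0⟩ : ∃ s, 1 ≤ s ∧ (p = 2 → s = 2) ∧
      ⁅(⊤ : Subgroup G), ⊤⁆ ≤ powerSeries G p s := by
    rcases hG.commutator_le with ⟨h2, h⟩ | ⟨rfl, h⟩
    · exact ⟨1, le_rfl, by omega, h⟩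
    · refine ⟨2, by omega, fun _ => rfl, h.trans (powerSubgroup_le_iff.2 fun x hx => ?_)⟩
      exact pow_pow_mem_powerSeries (p := 2) (k := 0) hx 2
  have hs2' : p = 2 → 2 ≤ s := fun h => (hs2 h).ge
  have hc := commutator_powerSeries_le hp hs hs2' h0
  exact ⟨s, hs, hs2, powerSeries_normal, powerSeries_antitone,
    fun hx hy => hc _ _ (Subgroup.commutator_mem_commutator hx hy), pow_mem_powerSeries,
    exists_root_powerSeries hp hs hs2' hc hM⟩

/-- Repeated root extraction makes each element of the k-th iterated term a single p^k-th power. -/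
theorem IsPowerful.powerSubgroup_top_eq_powerSeries (hp : p.Prime) (hG : IsPowerful p G) (k : ℕ) :
    powerSubgroup (⊤ : Subgroup G) (p ^ k) = powerSeries G p k := by
  obtain ⟨s, -, -, hN⟩ := hG.exists_isPowerFiltration hp
  apply le_antisymm
  · rw [powerSubgroup_le_iff]
    intro x hx
    simpa using pow_pow_mem_powerSeries (p := p) (k := 0) hx k
  · intro x hx
    suffices ∀ k x, x ∈ powerSeries G p k → ∃ w, w ^ p ^ k = x by
      obtain ⟨w, rfl⟩ := this k x hx
      exact pow_mem_powerSubgroup (Subgroup.mem_top w) _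
    intro k
    induction k with
    | zero => exact fun x _ => ⟨x, by simp⟩
    | succ k ih =>
      intro x hx
      obtain ⟨w, hw, rfl⟩ := hN.exists_root hx
      obtain ⟨u, rfl⟩ := ih w hw
      exact ⟨u, by rw [pow_succ, pow_mul]⟩

theorem IsPowerful.isTorsionClosed (hp : p.Prime) (hG : IsPowerful p G) {k : ℕ} (hk : 1 ≤ k) :
    IsTorsionClosed p (powerSubgroup (⊤ : Subgroup G) (p ^ k)) := by
  have := hG.finite
  obtain ⟨s, hs, hs2, hN⟩ := hG.exists_isPowerFiltration hp
  obtain ⟨M, hM⟩ := exists_powerSeries_eq_bot hp hG.isPGroup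
  rw [hG.powerSubgroup_top_eq_powerSeries hp]
  exact (isTorsionClosed_one hp hs hs2 hN hM).mono (hN.antitone hk)

theorem IsTorsionClosed.mem_omega_iff {H : Subgroup G} (h : IsTorsionClosed p H) {i : ℕ} {x : G} :
    x ∈ omega p (i : ℤ) H ↔ x ∈ H ∧ x ^ p ^ i = 1 := by
  simp only [omega, Int.natCast_nonneg, if_true, Int.toNat_natCast, orderOf_dvd_iff_pow_eq_one]
  refine ⟨fun hx => ?_, fun hx => Subgroup.subset_closure hx⟩
  induction hx using Subgroup.closure_induction with
  | mem x hx => exact hx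
  | one => exact ⟨H.one_mem, one_pow _⟩
  | mul x y _ _ hx hy => exact ⟨H.mul_mem hx.1 hy.1, h i x y hx.1 hy.1 hx.2 hy.2⟩
  | inv x _ hx => exact ⟨H.inv_mem hx.1, by rw [inv_pow, hx.2, inv_one]⟩

end PowerfulGroup

theorem mainTheorem3 {G : Type*} [Group G] (p : ℕ) (hp : p.Prime)
    (hG : PowerfulGroup.IsPowerful p G) (i j k : ℕ) (hk : 1 ≤ k) :
    PowerfulGroup.powerSubgroup
        (PowerfulGroup.omega p (i : ℤ) (PowerfulGroup.powerSubgroup (⊤ : Subgroup G) (p ^ k)))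
        (p ^ j) ≤
      PowerfulGroup.omega p ((i : ℤ) - (j : ℤ))
        (PowerfulGroup.powerSubgroup (⊤ : Subgroup G) (p ^ (k + j))) ∧
    PowerfulGroup.ExponentLE p ((i : ℤ) - (j : ℤ))
      (PowerfulGroup.powerSubgroup
        (PowerfulGroup.omega p (i : ℤ) (PowerfulGroup.powerSubgroup (⊤ : Subgroup G) (p ^ k)))
        (p ^ j)) := by
  have hcl := fun k (hk : 1 ≤ k) => hG.isTorsionClosed hp hk
  have hpow : ∀ x ∈ PowerfulGroup.powerSubgroup (⊤ : Subgroup G) (p ^ k),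
      x ^ p ^ j ∈ PowerfulGroup.powerSubgroup (⊤ : Subgroup G) (p ^ (k + j)) := by
    rw [hG.powerSubgroup_top_eq_powerSeries hp, hG.powerSubgroup_top_eq_powerSeries hp]
    exact fun x hx => PowerfulGroup.pow_pow_mem_powerSeries hx j
  rcases le_or_gt j i with hij | hij
  · obtain ⟨c, rfl⟩ := Nat.exists_eq_add_of_le hij
    have hsub : ((j + c : ℕ) : ℤ) - (j : ℤ) = (c : ℕ) := by push_cast; ring
    rw [hsub]
    have hle : PowerfulGroup.powerSubgroup (PowerfulGroup.omega p ((j + c : ℕ) : ℤ)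
        (PowerfulGroup.powerSubgroup (⊤ : Subgroup G) (p ^ k))) (p ^ j) ≤
        PowerfulGroup.omega p (c : ℤ)
          (PowerfulGroup.powerSubgroup (⊤ : Subgroup G) (p ^ (k + j))) := by
      rw [PowerfulGroup.powerSubgroup_le_iff]
      intro x hx
      rw [(hcl k hk).mem_omega_iff] at hx
      rw [(hcl (k + j) (by omega)).mem_omega_iff, ← pow_mul, ← pow_add]
      exact ⟨hpow x hx.1, hx.2⟩
    refine ⟨hle, ?_⟩
    simp only [PowerfulGroup.ExponentLE, Int.natCast_nonneg, if_true, Int.toNat_natCast]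
    refine Nat.le_of_dvd (pow_pos hp.pos c) (Monoid.exponent_dvd_of_forall_pow_eq_one fun x => ?_)
    exact Subtype.ext (((hcl (k + j) (by omega)).mem_omega_iff).1 (hle x.2)).2
  · have hneg : ¬ (0 : ℤ) ≤ (i : ℤ) - (j : ℤ) := by omega
    have hbot : PowerfulGroup.powerSubgroup (PowerfulGroup.omega p (i : ℤ)
        (PowerfulGroup.powerSubgroup (⊤ : Subgroup G) (p ^ k))) (p ^ j) = ⊥ := by
      rw [eq_bot_iff, PowerfulGroup.powerSubgroup_le_iff]
      intro x hx
      rw [(hcl k hk).mem_omega_iff] at hx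
      exact PowerfulGroup.pow_prime_pow_mono hx.2 hij.le
    exact ⟨hbot ▸ bot_le, by simp only [PowerfulGroup.ExponentLE, hneg, if_false, hbot]⟩
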